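/- Let $\mathcal X$ be a metric space with its Borel $\sigma$-algebra $\mathfrak B(\mathcal X)$, let $\varepsilon>0$, and let $B_\varepsilon(x)$ denote the open ball. Let $\mu$ be a Borel probability measure on $\mathcal X\times\{0,1\}$ (with the product $\sigma$-algebra $\mathfrak B(\mathcal X)\otimes 2^{\{0,1\}}$); put $\rho_i(B)=\mu(B\times\{i\})$ for $i\in\{0,1\}$ and $\rho=\rho_0+\rho_1$, and assume that $\rho$ is concentrated on its support, $\rho(\mathcal X\setminus\operatorname{supp}\rho)=0$ (this is automatic if $\mathcal X$ is separable). Let $\{\mathfrak m_x\}_{x\in\mathcal X}$ be a family of Borel measures on $\mathcal X$ depending measurably on $x$ (up to a $\rho$-null set), such that $\mathfrak m_x$ is a probability measure for $\rho$-almost every $x$. Put $$\nu(B)=\tfrac12\int_{\mathcal X}\mathfrak m_x(B)\,d\rho(x)+\tfrac12\rho(B),\qquad \Psi_p(t)=\min\{t/p,1\}\quad(p>0),$$ and, for Borel sets $A$, with $A^{\oplus\varepsilon}=\bigcup_{a\in A}B_\varepsilon(a)$, $$R_{\mathrm{std}}(A)=\rho_0(A)+\rho_1(A^c),\qquad R_{\mathrm{adv}}(A)=\rho_0\big(A^{\oplus\varepsilon}\big)+\rho_1\big((A^c)^{\oplus\varepsilon}\big),$$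 $$R_{\Psi_p}(A)=\int_{\mathcal X}\Psi_p(\mathfrak m_x(A))\,d\rho_0(x)+\int_{\mathcal X}\Psi_p(\mathfrak m_x(A^c))\,d\rho_1(x),$$ $$\mathrm{ProbR}_{\Psi_p}(A)=R_{\mathrm{std}}(A)+\int_{A^c}\Psi_p(\mathfrak m_x(A))\,d\rho_0(x)+\int_{A}\Psi_p(\mathfrak m_x(A^c))\,d\rho_1(x).$$ Assume that for every $x\in\operatorname{supp}(\rho)$: 1. $\mathfrak m_x(\mathcal X\setminus B_\varepsilon(x))=0$; 2. $B_\varepsilon(x)\subseteq\operatorname{supp}(\mathfrak m_x)$; 3. for every $x'\in\operatorname{supp}(\rho)$, the restriction of $\mathfrak m_{x'}$ to $B_\varepsilon(x)$ is absolutely continuous with respect to $\mathfrak m_x$; 4. the restriction of $\rho$ to $B_\varepsilon(x)$ is absolutely continuous with respect to $\mathfrak m_x$. **Theorem.** Suppose that for every $p>0$ the set $A_p$ is a minimizer of $\mathrm{ProbR}_{\Psi_p}$ over $\mathfrak B(\mathcal X)$, and that, as $p\to0$, $A_p$ converges to a Borel set $A$ in the weak-* topology of $L^\infty(\mathcal X;\nu)$,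 i.e. $\int_{\mathcal X}\mathbf 1_{A_p}\varphi\,d\nu\to\int_{\mathcal X}\mathbf 1_A\varphi\,d\nu$ for every $\varphi\in L^1(\mathcal X;\nu)$. Then there is a Borel set $A'$ with $\nu(A'\,\triangle\,A)=0$ that minimizes $R_{\mathrm{adv}}$ over $\mathfrak B(\mathcal X)$. The same holds with $R_{\Psi_p}$ in place of $\mathrm{ProbR}_{\Psi_p}$. -/

import Mathlib

open MeasureTheory Filter Topology
open scoped ENNReal

noncomputable section

namespace ProbRobust

variable {X : Type*} [MetricSpace X] [MeasurableSpace X]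

/-- The data distribution `ρ`: the first marginal of `μ`. -/
def rho (μ : Measure (X × Fin 2)) : Measure X :=
  μ.map Prod.fst

/-- `ρ_i(B) = μ(B × {i})`, the distribution of the data carrying the label `i`. -/
def rhoLabel (μ : Measure (X × Fin 2)) (i : Fin 2) : Measure X :=
  (μ.restrict (Prod.snd ⁻¹' {i})).map Prod.fst

/-- `ν(B) = (1/2) ∫ m_x(B) dρ(x) + (1/2) ρ(B)`. -/
def nu (μ : Measure (X × Fin 2)) (m : X → Measure X) : Measure X :=
  (2⁻¹ : ℝ≥0∞) • (rho μ).bind m + (2⁻¹ : ℝ≥0∞) • rho μ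

/-- `Ψ_p(t) = min {t / p, 1}`, used for `p > 0`. -/
def Psi (p : ℝ) (t : ℝ≥0∞) : ℝ≥0∞ :=
  min (t / ENNReal.ofReal p) 1

/-- The standard risk for the 0-1 loss, `E_{(x,y)∼μ} [y 1_{x ∈ Aᶜ} + (1 - y) 1_{x ∈ A}]`. -/
def riskStd (μ : Measure (X × Fin 2)) (A : Set X) : ℝ≥0∞ :=
  ∫⁻ z, (if z.2 = 1 then Aᶜ.indicator 1 z.1 else A.indicator 1 z.1) ∂μ

/-- The adversarial risk,
`E_{(x,y)∼μ} [y 1_{x ∈ (Aᶜ)^{⊕ε}} + (1 - y) 1_{x ∈ A^{⊕ε}}]`, where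
`A^{⊕ε} = ⋃ a ∈ A, ball a ε` is the fattening of `A` by open balls. -/
def riskAdv (μ : Measure (X × Fin 2)) (ε : ℝ) (A : Set X) : ℝ≥0∞ :=
  ∫⁻ z, (if z.2 = 1 then (⋃ a ∈ Aᶜ, Metric.ball a ε).indicator 1 z.1
    else (⋃ a ∈ A, Metric.ball a ε).indicator 1 z.1) ∂μ

/-- The risk `R_Ψ` of the original probabilistically robust learning model. -/
def riskPsi (μ : Measure (X × Fin 2)) (m : X → Measure X) (Ψ : ℝ≥0∞ → ℝ≥0∞) (A : Set X) :
    ℝ≥0∞ :=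
  ∫⁻ x, Ψ (m x A) ∂(rhoLabel μ 0) + ∫⁻ x, Ψ (m x Aᶜ) ∂(rhoLabel μ 1)

/-- The probabilistic perimeter `ProbPer_Ψ`. -/
def probPer (μ : Measure (X × Fin 2)) (m : X → Measure X) (Ψ : ℝ≥0∞ → ℝ≥0∞) (A : Set X) :
    ℝ≥0∞ :=
  ∫⁻ x in Aᶜ, Ψ (m x A) ∂(rhoLabel μ 0) + ∫⁻ x in A, Ψ (m x Aᶜ) ∂(rhoLabel μ 1)

/-- The risk `ProbR_Ψ` of the modified probabilistically robust learning model. -/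
def probRisk (μ : Measure (X × Fin 2)) (m : X → Measure X) (Ψ : ℝ≥0∞ → ℝ≥0∞) (A : Set X) :
    ℝ≥0∞ :=
  riskStd μ A + probPer μ m Ψ A

/-- `A` is a minimizer of `F` over the class of all Borel sets. -/
def IsBorelMinimizer (F : Set X → ℝ≥0∞) (A : Set X) : Prop :=
  MeasurableSet A ∧ ∀ B : Set X, MeasurableSet B → F A ≤ F B

/-- As `p ↓ 0`, the sets `A p` converge to the set `A₀` (through their indicator functions) in the
weak-* topology of `L^∞(ν)`, the dual of `L^1(ν)`. -/
def WeakStarConverges (ν : Measure X) (A : ℝ → Set X) (A₀ : Set X) : Prop :=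
  ∀ φ : X → ℝ, Integrable φ ν →
    Tendsto (fun p : ℝ => ∫ x, (A p).indicator 1 x * φ x ∂ν) (𝓝[>] 0)
      (𝓝 (∫ x, A₀.indicator 1 x * φ x ∂ν))

/-- The compatibility of the family `m` with the balls of radius `ε` and with the data measure:
for every `x` in the support of `ρ`, `m_x` is concentrated on `ball x ε`, its support contains
`ball x ε`, and it dominates the restriction to `ball x ε` of each `m_{x'}`, `x' ∈ supp ρ`. -/
structure BallCompatible (ρ : Measure X) (m : X → Measure X) (ε : ℝ) : Prop where
  concentrated : ∀ x ∈ ρ.support, m x (Metric.ball x ε)ᶜ = 0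
  ball_subset_support : ∀ x ∈ ρ.support, Metric.ball x ε ⊆ (m x).support
  restrict_absolutelyContinuous : ∀ x ∈ ρ.support, ∀ x' ∈ ρ.support,
    (m x').restrict (Metric.ball x ε) ≪ m x

/-- For every `x` in the support of `ρ`, `m_x` dominates the restriction of `ρ` to `ball x ε`. -/
def DominatesData (ρ : Measure X) (m : X → Measure X) (ε : ℝ) : Prop :=
  ∀ x ∈ ρ.support, ρ.restrict (Metric.ball x ε) ≪ m x

end ProbRobust

end

open TopologicalSpace

set_option linter.unusedSectionVars false

namespace ProbRobust

/-! On Borel sets `riskPsi ≤ probRisk ≤ riskAdv`, so in both models the minimizers satisfy `riskPsi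
(A p) ≤ riskAdv B` for every Borel `B`. It remains to bound the left side below as `p → 0`. For `x`
in the support, `m x ≪ ν` (`absolutelyContinuous_nu`), so weak-* convergence gives `m x (A p) → m x
A₀`; where the limit is positive, `Psi p` is eventually `1`. Fatou then bounds the liminf below by
the mass of the label-0 points with `m x A₀ > 0` plus that of the label-1 points with `m x A₀ᶜ > 0`.
This dominates the adversarial risk of a set `A'` for which `x` lies in the fattening of `A'` only
if `m x A₀ > 0`, and likewise for complements. `exists_representative` finds such an `A'` in the
`ν`-class of `A₀`. -/

/-! ### Separability and unions of balls -/

/-- The support of a finite Borel measure on a metric space is separable. -/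
theorem isSeparable_support {X : Type*} [MetricSpace X] [MeasurableSpace X] [BorelSpace X]
    (ρ : Measure X) [IsFiniteMeasure ρ] : IsSeparable ρ.support := by
  suffices h : ∃ t, t ⊆ ρ.support ∧ t.Countable ∧ ρ.support ⊆ closure t by
    obtain ⟨t, -, ht, hs⟩ := h
    exact ⟨t, ht, hs⟩
  refine EMetric.subset_countable_closure_of_almost_dense_set _ fun ε hε => ?_
  obtain ⟨δ, hδ, hδε⟩ := ENNReal.lt_iff_exists_nnreal_btwn.1 hε
  have hδ0 : (δ : ℝ≥0∞) ≠ 0 := hδ.ne'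
  -- A maximal `δ`-separated subset of the support is a `δ`-net. It is countable, since the balls of
  -- radius `δ / 2` about its points are disjoint and each has positive mass.
  obtain ⟨N, hN⟩ : ∃ N, Maximal (fun N => N ⊆ ρ.support ∧ Metric.IsSeparated (δ : ℝ≥0∞) N) N := by
    refine zorn_subset {N | N ⊆ ρ.support ∧ Metric.IsSeparated (δ : ℝ≥0∞) N} fun c hc hchain =>
      ⟨⋃₀ c, ⟨Set.sUnion_subset fun s hs => (hc hs).1, ?_⟩, fun s hs => Set.subset_sUnion_of_mem hs⟩
    exact (Set.pairwise_sUnion hchain.directedOn).2 fun s hs => (hc hs).2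
  have hcover := Metric.IsCover.of_maximal_isSeparated hN
  refine ⟨N, ?_, fun x hx => ?_⟩
  · have hdisj : Pairwise (Function.onFun Disjoint fun x : N => Metric.eball (x : X) (δ / 2)) := by
      intro x y hxy
      refine Set.disjoint_left.2 fun z hzx hzy => ?_
      have h1 : (δ : ℝ≥0∞) < edist (x : X) y := hN.prop.2 x.2 y.2 fun h => hxy (Subtype.ext h)
      have h2 : edist (x : X) y < δ / 2 + δ / 2 :=
        (edist_triangle_left (x : X) y z).trans_lt (ENNReal.add_lt_add hzx hzy)
      rw [ENNReal.add_halves] at h2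
      exact lt_asymm h1 h2
    have hcount := Measure.countable_meas_pos_of_disjoint_iUnion (μ := ρ)
      (fun x : N => (Metric.isOpen_eball (x := (x : X)) (ε := δ / 2)).measurableSet) hdisj
    have huniv : {x : N | 0 < ρ (Metric.eball (x : X) (δ / 2))} = Set.univ :=
      Set.eq_univ_of_forall fun x => (Measure.mem_support_iff_forall _).1 (hN.prop.1 x.2) _
        (Metric.eball_mem_nhds _ (ENNReal.half_pos hδ0))
    rw [huniv, Set.countable_univ_iff] at hcount
    exact hcount
  · obtain ⟨y, hy, hxy⟩ := hcover hx
    exact Set.mem_biUnion hy (le_trans hxy hδε.le)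

/-- A union of balls of a fixed radius with centres in a separable set is a countable union of
such balls. -/
theorem exists_countable_biUnion_ball_eq {X : Type*} [MetricSpace X] {T : Set X}
    (hT : IsSeparable T) (ε : ℝ) :
    ∃ D ⊆ T, D.Countable ∧ ⋃ x ∈ D, Metric.ball x ε = ⋃ x ∈ T, Metric.ball x ε := by
  obtain ⟨D, hDT, hD, hcl⟩ := hT.exists_countable_dense_subset
  refine ⟨D, hDT, hD, (Set.biUnion_subset_biUnion_left hDT).antisymm ?_⟩
  refine Set.iUnion₂_subset fun x hx y hy => ?_
  rw [Metric.mem_ball, dist_comm] at hy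
  obtain ⟨z, hz, hzD⟩ := mem_closure_iff.1 (hcl hx) (Metric.ball y ε) Metric.isOpen_ball hy
  exact Set.mem_biUnion hzD (by rwa [Metric.mem_ball, dist_comm])

theorem measure_inter_biUnion_ball_eq_zero {X : Type*} [MetricSpace X] [MeasurableSpace X]
    {T : Set X} (hT : IsSeparable T) {ε : ℝ} {κ : Measure X} {A : Set X}
    (h : ∀ x ∈ T, κ (A ∩ Metric.ball x ε) = 0) :
    κ (A ∩ ⋃ x ∈ T, Metric.ball x ε) = 0 := by
  obtain ⟨D, hDT, hD, heq⟩ := exists_countable_biUnion_ball_eq hT ε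
  rw [← heq, Set.inter_iUnion₂]
  exact (measure_biUnion_null_iff hD).2 fun x hx => h x (hDT hx)

/-! ### Null sets of `ν` -/

variable {X : Type*} [MetricSpace X] [MeasurableSpace X] {μ : Measure (X × Fin 2)}
  {m : X → Measure X} {ε : ℝ}

instance isProbabilityMeasure_rho [IsProbabilityMeasure μ] : IsProbabilityMeasure (rho μ) :=
  Measure.isProbabilityMeasure_map measurable_fst.aemeasurable

theorem rhoLabel_le_rho (i : Fin 2) : rhoLabel μ i ≤ rho μ :=
  Measure.map_mono Measure.restrict_le_self measurable_fst

theorem rhoLabel_absolutelyContinuous (i : Fin 2) : rhoLabel μ i ≪ rho μ :=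
  Measure.absolutelyContinuous_of_le (rhoLabel_le_rho i)

theorem isFiniteMeasure_nu [IsProbabilityMeasure μ] (hm : AEMeasurable m (rho μ))
    (hprob : ∀ᵐ x ∂(rho μ), IsProbabilityMeasure (m x)) : IsFiniteMeasure (nu μ m) := by
  refine ⟨?_⟩
  have h : ∫⁻ x, m x Set.univ ∂(rho μ) = ∫⁻ _, 1 ∂(rho μ) :=
    lintegral_congr_ae (hprob.mono fun x hx => hx.measure_univ)
  simp [nu, Measure.bind_apply MeasurableSet.univ hm, h, ENNReal.inv_lt_top]

theorem nu_eq_zero_iff (hm : AEMeasurable m (rho μ)) {N : Set X} (hN : MeasurableSet N) :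
    nu μ m N = 0 ↔ (∀ᵐ x ∂(rho μ), m x N = 0) ∧ rho μ N = 0 := by
  have h := lintegral_eq_zero_iff' ((Measure.measurable_coe hN).comp_aemeasurable hm)
  simp only [nu, Measure.add_apply, Measure.smul_apply, smul_eq_mul, add_eq_zero, mul_eq_zero,
    ENNReal.inv_eq_zero, ENNReal.ofNat_ne_top, false_or, Measure.bind_apply hN hm]
  exact and_congr_left fun _ => h

theorem BallCompatible.measure_inter_ball_eq_zero [BorelSpace X] {ρ : Measure X}
    (hball : BallCompatible ρ m ε) {x x' : X} (hx : x ∈ ρ.support) (hx' : x' ∈ ρ.support)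
    {N : Set X} (hN : m x' N = 0) : m x (N ∩ Metric.ball x' ε) = 0 := by
  rw [← Measure.restrict_apply' Metric.isOpen_ball.measurableSet]
  exact hball.restrict_absolutelyContinuous x' hx' x hx hN

/-- A `ν`-null set is `m y`-null only for almost every `y`, but such `y` are dense in the support,
so their balls cover `ball x ε`. On each of these balls `m x` is dominated by `m y`, and countably
many of them suffice. -/
theorem absolutelyContinuous_nu [IsFiniteMeasure (rho μ)] [BorelSpace X]
    (hsupp : rho μ (rho μ).supportᶜ = 0)
    (hm : AEMeasurable m (rho μ)) (hball : BallCompatible (rho μ) m ε) {x : X}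
    (hx : x ∈ (rho μ).support) : m x ≪ nu μ m := by
  refine Measure.AbsolutelyContinuous.mk fun N hN hNν => ?_
  have hae := ((nu_eq_zero_iff hm hN).1 hNν).1
  have hS : ∀ᵐ y ∂(rho μ), y ∈ (rho μ).support := hsupp
  have hdense : x ∈ closure {y | y ∈ (rho μ).support ∧ m y N = 0} := by
    refine mem_closure_iff.2 fun o ho hxo => ?_
    have hpos := (Measure.mem_support_iff_forall x).1 hx o (ho.mem_nhds hxo)
    have hfreq : ∃ᵐ y ∂(rho μ), y ∈ o := by
      rw [frequently_ae_iff]; exact hpos.ne'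
    obtain ⟨y, hyo, hy⟩ := (hfreq.and_eventually (hS.and hae)).exists
    exact ⟨y, hyo, hy⟩
  have hnull : m x (N ∩ ⋃ y ∈ {y | y ∈ (rho μ).support ∧ m y N = 0}, Metric.ball y ε) = 0 :=
    measure_inter_biUnion_ball_eq_zero ((isSeparable_support (rho μ)).mono fun _ h => h.1)
      fun y hy => hball.measure_inter_ball_eq_zero hx hy.1 hy.2
  refine measure_mono_null (fun z hz => ?_)
    (measure_union_null hnull (hball.concentrated x hx))
  by_cases hzx : z ∈ Metric.ball x ε
  · rw [Metric.mem_ball, dist_comm] at hzx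
    obtain ⟨y, hy, hyS⟩ := mem_closure_iff.1 hdense (Metric.ball z ε) Metric.isOpen_ball hzx
    exact Or.inl ⟨hz, Set.mem_biUnion hyS (by rwa [Metric.mem_ball, dist_comm])⟩
  · exact Or.inr hzx

/-! ### The good representative -/

theorem isOpen_thickening_balls (ε : ℝ) (A : Set X) : IsOpen (⋃ a ∈ A, Metric.ball a ε) :=
  isOpen_biUnion fun _ _ => Metric.isOpen_ball

/-- A Borel set can be modified on a `ν`-null set in such a way that its intersection with
`ball x ε`, `x ∈ supp ρ`, is empty as soon as it is `m_x`-null, and similarly for its complement. -/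
theorem exists_representative [BorelSpace X] [IsFiniteMeasure (rho μ)]
    (hsupp : rho μ (rho μ).supportᶜ = 0) (hm : AEMeasurable m (rho μ))
    (hball : BallCompatible (rho μ) m ε) (hdom : DominatesData (rho μ) m ε)
    {A : Set X} (hA : MeasurableSet A) :
    ∃ A' : Set X, MeasurableSet A' ∧ nu μ m (symmDiff A' A) = 0 ∧
      ∀ x ∈ (rho μ).support, (m x A = 0 → x ∉ ⋃ a ∈ A', Metric.ball a ε) ∧
        (m x Aᶜ = 0 → x ∉ ⋃ a ∈ A'ᶜ, Metric.ball a ε) := by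
  let W : Set X → Set X := fun B => ⋃ x ∈ {x | x ∈ (rho μ).support ∧ m x B = 0}, Metric.ball x ε
  have hWopen : ∀ B, IsOpen (W B) := fun B => isOpen_thickening_balls _ _
  have hWsep : ∀ B, IsSeparable {x | x ∈ (rho μ).support ∧ m x B = 0} := fun B =>
    (isSeparable_support (rho μ)).mono fun _ h => h.1
  have hS : ∀ᵐ y ∂(rho μ), y ∈ (rho μ).support := hsupp
  have hWnull : ∀ B, MeasurableSet B → nu μ m (B ∩ W B) = 0 := by
    intro B hB
    refine (nu_eq_zero_iff hm (hB.inter (hWopen B).measurableSet)).2 ⟨?_, ?_⟩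
    · filter_upwards [hS] with x hx
      exact measure_inter_biUnion_ball_eq_zero (hWsep B)
        fun y hy => hball.measure_inter_ball_eq_zero hx hy.1 hy.2
    · refine measure_inter_biUnion_ball_eq_zero (hWsep B) fun y hy => ?_
      rw [← Measure.restrict_apply' Metric.isOpen_ball.measurableSet]
      exact hdom y hy.1 hy.2
  -- At a common point `z` of `ball x ε` and `ball x' ε`, the ball about `x'` has positive `m
  -- x`-mass; yet `A` is `m x`-null, and so is the part of `Aᶜ` in that ball, by domination by `m
  -- x'`.
  have hdisj : Disjoint (W A) (W Aᶜ) := by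
    refine Set.disjoint_left.2 fun z hz hz' => ?_
    obtain ⟨x, ⟨hx, hxA⟩, hzx⟩ := Set.mem_iUnion₂.1 hz
    obtain ⟨x', ⟨hx', hxA'⟩, hzx'⟩ := Set.mem_iUnion₂.1 hz'
    have hpos := (Measure.mem_support_iff_forall z).1 (hball.ball_subset_support x hx hzx)
      (Metric.ball x' ε) (Metric.isOpen_ball.mem_nhds hzx')
    refine hpos.ne' (measure_mono_null (fun w hw => ?_)
      (measure_union_null hxA (hball.measure_inter_ball_eq_zero hx hx' hxA')))
    by_cases hwA : w ∈ A
    · exact Or.inl hwA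
    · exact Or.inr ⟨hwA, hw⟩
  -- By disjointness, removing `W A` leaves the added `W Aᶜ` intact.
  refine ⟨(A ∪ W Aᶜ) \ W A, (hA.union (hWopen _).measurableSet).diff (hWopen _).measurableSet,
    measure_mono_null ?_ (measure_union_null (hWnull A hA) (hWnull Aᶜ hA.compl)), ?_⟩
  · rintro z (⟨⟨hz | hz, -⟩, hzA⟩ | ⟨hzA, hz⟩)
    · exact absurd hz hzA
    · exact Or.inr ⟨hzA, hz⟩
    · refine Or.inl ⟨hzA, ?_⟩
      by_contra hzW
      exact hz ⟨Or.inl hzA, hzW⟩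
  · refine fun x hx => ⟨fun hxA hmem => ?_, fun hxA hmem => ?_⟩
    · obtain ⟨a, ha, hxa⟩ := Set.mem_iUnion₂.1 hmem
      exact ha.2 (Set.mem_biUnion (show x ∈ {x | x ∈ (rho μ).support ∧ m x A = 0} from ⟨hx, hxA⟩)
        (by rwa [Metric.mem_ball, dist_comm]))
    · obtain ⟨a, ha, hxa⟩ := Set.mem_iUnion₂.1 hmem
      have haW : a ∈ W Aᶜ :=
        Set.mem_biUnion (show x ∈ {x | x ∈ (rho μ).support ∧ m x Aᶜ = 0} from ⟨hx, hxA⟩)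
          (by rwa [Metric.mem_ball, dist_comm])
      exact ha ⟨Or.inr haW, Set.disjoint_right.1 hdisj haW⟩

/-! ### Comparison of the risks -/

/-- Disintegration of an integral with respect to `μ` along the label. -/
theorem lintegral_label {F G : X → ℝ≥0∞} (hF : AEMeasurable F (rho μ))
    (hG : AEMeasurable G (rho μ)) :
    ∫⁻ z, (if z.2 = 1 then F z.1 else G z.1) ∂μ
      = ∫⁻ x, G x ∂(rhoLabel μ 0) + ∫⁻ x, F x ∂(rhoLabel μ 1) := by
  have hms : ∀ i : Fin 2, MeasurableSet (Prod.snd ⁻¹' {i} : Set (X × Fin 2)) := fun i =>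
    measurable_snd (measurableSet_singleton i)
  have hcompl : (Prod.snd ⁻¹' {0} : Set (X × Fin 2))ᶜ = Prod.snd ⁻¹' {1} := by
    ext ⟨x, i⟩
    fin_cases i <;> simp
  have hmap : ∀ (i : Fin 2) {H : X → ℝ≥0∞}, AEMeasurable H (rho μ) →
      ∫⁻ x, H x ∂(rhoLabel μ i) = ∫⁻ z in Prod.snd ⁻¹' {i}, H z.1 ∂μ := fun i H hH =>
    lintegral_map' (hH.mono_ac (rhoLabel_absolutelyContinuous i)) measurable_fst.aemeasurable
  rw [hmap 0 hG, hmap 1 hF, ← lintegral_add_compl _ (hms 0), hcompl]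
  refine congr_arg₂ _ (setLIntegral_congr_fun (hms 0) fun z hz => ?_)
    (setLIntegral_congr_fun (hms 1) fun z hz => ?_)
  · have : z.2 = 0 := hz
    simp [this]
  · have : z.2 = 1 := hz
    simp [this]

theorem aemeasurable_Psi (hm : AEMeasurable m (rho μ)) (p : ℝ) {B : Set X}
    (hB : MeasurableSet B) : AEMeasurable (fun x => Psi p (m x B)) (rho μ) :=
  (((Measure.measurable_coe hB).comp_aemeasurable hm).div_const _).min aemeasurable_const

theorem riskPsi_eq_lintegral (hm : AEMeasurable m (rho μ)) (p : ℝ) {A : Set X}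
    (hA : MeasurableSet A) :
    riskPsi μ m (Psi p) A
      = ∫⁻ z, (if z.2 = 1 then Psi p (m z.1 Aᶜ) else Psi p (m z.1 A)) ∂μ :=
  (lintegral_label (aemeasurable_Psi hm p hA.compl) (aemeasurable_Psi hm p hA)).symm

theorem riskStd_eq_add {A : Set X} (hA : MeasurableSet A) :
    riskStd μ A = rhoLabel μ 0 A + rhoLabel μ 1 Aᶜ := by
  have h : ∀ {B : Set X}, MeasurableSet B → AEMeasurable (B.indicator 1 : X → ℝ≥0∞) (rho μ) :=
    fun hB => (measurable_one.indicator hB).aemeasurable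
  rw [riskStd, lintegral_label (h hA.compl) (h hA), lintegral_indicator_one hA,
    lintegral_indicator_one hA.compl]

theorem riskAdv_eq_add [BorelSpace X] (ε : ℝ) (A : Set X) :
    riskAdv μ ε A = rhoLabel μ 0 (⋃ a ∈ A, Metric.ball a ε)
      + rhoLabel μ 1 (⋃ a ∈ Aᶜ, Metric.ball a ε) := by
  have h : ∀ B : Set X, MeasurableSet (⋃ a ∈ B, Metric.ball a ε) := fun B =>
    (isOpen_thickening_balls ε B).measurableSet
  have h' : ∀ B : Set X,
      AEMeasurable ((⋃ a ∈ B, Metric.ball a ε).indicator 1 : X → ℝ≥0∞) (rho μ) :=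
    fun B => (measurable_one.indicator (h B)).aemeasurable
  rw [riskAdv, lintegral_label (h' _) (h' _), lintegral_indicator_one (h _),
    lintegral_indicator_one (h _)]

theorem Psi_le_one (p : ℝ) (t : ℝ≥0∞) : Psi p t ≤ 1 :=
  min_le_right _ _

theorem riskPsi_le_probRisk (p : ℝ) {A : Set X} (hA : MeasurableSet A) :
    riskPsi μ m (Psi p) A ≤ probRisk μ m (Psi p) A := by
  have h : ∀ (κ : Measure X) {B : Set X}, MeasurableSet B → ∀ f : X → ℝ≥0∞, (∀ x, f x ≤ 1) →
      ∫⁻ x, f x ∂κ ≤ κ B + ∫⁻ x in Bᶜ, f x ∂κ := by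
    intro κ B hB f hf
    rw [← lintegral_add_compl f hB]
    gcongr
    calc ∫⁻ x in B, f x ∂κ ≤ ∫⁻ _ in B, 1 ∂κ := lintegral_mono hf
      _ = κ B := by simp
  have h0 := h (rhoLabel μ 0) hA (fun x => Psi p (m x A)) fun _ => Psi_le_one _ _
  have h1 := h (rhoLabel μ 1) hA.compl (fun x => Psi p (m x Aᶜ)) fun _ => Psi_le_one _ _
  rw [compl_compl] at h1
  rw [probRisk, riskStd_eq_add hA, probPer, riskPsi, add_add_add_comm]
  exact add_le_add h0 h1

/-- If `x` is outside the fattening of `B`, then `ball x ε` misses `B`, so `m x B = 0` and the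
penalty vanishes; elsewhere it is at most `1`. -/
theorem probRisk_le_riskAdv [BorelSpace X] (hsupp : rho μ (rho μ).supportᶜ = 0)
    (hball : BallCompatible (rho μ) m ε) (hε : 0 < ε) (p : ℝ) {A : Set X}
    (hA : MeasurableSet A) : probRisk μ m (Psi p) A ≤ riskAdv μ ε A := by
  have h : ∀ (i : Fin 2) {B : Set X}, MeasurableSet B →
      rhoLabel μ i B + ∫⁻ x in Bᶜ, Psi p (m x B) ∂(rhoLabel μ i)
        ≤ rhoLabel μ i (⋃ a ∈ B, Metric.ball a ε) := by
    intro i B hB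
    have hBε : MeasurableSet (⋃ a ∈ B, Metric.ball a ε) :=
      (isOpen_thickening_balls ε B).measurableSet
    have hS : ∀ᵐ x ∂(rhoLabel μ i), x ∈ (rho μ).support :=
      rhoLabel_absolutelyContinuous i hsupp
    have hle : ∀ᵐ x ∂(rhoLabel μ i),
        Psi p (m x B) ≤ (⋃ a ∈ B, Metric.ball a ε).indicator 1 x := by
      filter_upwards [hS] with x hx
      by_cases hxB : x ∈ ⋃ a ∈ B, Metric.ball a ε
      · simpa [Set.indicator_of_mem hxB] using Psi_le_one p (m x B)
      · have h0 : m x B = 0 := by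
          refine measure_mono_null (t := (Metric.ball x ε)ᶜ) (fun a ha hax => hxB ?_)
            (hball.concentrated x hx)
          rw [Metric.mem_ball] at hax
          exact Set.mem_biUnion ha (by rwa [Metric.mem_ball, dist_comm])
        simp [h0, Psi]
    have hsub : B ⊆ ⋃ a ∈ B, Metric.ball a ε := fun a ha =>
      Set.mem_biUnion ha (Metric.mem_ball_self hε)
    calc _ ≤ rhoLabel μ i B
          + ∫⁻ x in Bᶜ, (⋃ a ∈ B, Metric.ball a ε).indicator 1 x ∂(rhoLabel μ i) :=
          add_le_add_right (lintegral_mono_ae (ae_restrict_of_ae hle)) _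
      _ = rhoLabel μ i ((⋃ a ∈ B, Metric.ball a ε) ∩ B)
          + rhoLabel μ i ((⋃ a ∈ B, Metric.ball a ε) \ B) := by
          rw [lintegral_indicator_one hBε, Measure.restrict_apply hBε,
            Set.inter_eq_right.2 hsub, Set.sdiff_eq]
      _ = _ := measure_inter_add_sdiff _ hB
  have h1 := h 1 hA.compl
  rw [compl_compl] at h1
  rw [probRisk, riskStd_eq_add hA, probPer, add_add_add_comm, riskAdv_eq_add]
  exact add_le_add (h 0 hA) h1

/-! ### The limit `p → 0` -/

/-- Weak-* convergence in `L^∞(ν)` tested with the density of a finite measure `κ ≪ ν`. -/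
theorem WeakStarConverges.tendsto_measureReal {ν κ : Measure X} [IsFiniteMeasure ν]
    [IsFiniteMeasure κ] (hκ : κ ≪ ν) {A : ℝ → Set X} {A₀ : Set X} (hA₀ : MeasurableSet A₀)
    (hA : ∀ p, 0 < p → MeasurableSet (A p)) (h : WeakStarConverges ν A A₀) :
    Tendsto (fun p => κ.real (A p)) (𝓝[>] 0) (𝓝 (κ.real A₀)) := by
  have key : ∀ {B : Set X}, MeasurableSet B →
      ∫ x, B.indicator 1 x * (κ.rnDeriv ν x).toReal ∂ν = κ.real B := by
    intro B hB
    rw [← Measure.setIntegral_toReal_rnDeriv hκ, ← integral_indicator hB]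
    refine integral_congr_ae (Eventually.of_forall fun x => ?_)
    by_cases hx : x ∈ B <;> simp [hx]
  have hlim := h _ (Measure.integrable_toReal_rnDeriv (μ := κ))
  rw [key hA₀] at hlim
  refine hlim.congr' ?_
  filter_upwards [self_mem_nhdsWithin] with p hp
  exact key (hA p hp)

/-- The masses tend to a positive limit while `p → 0`, so eventually `p` lies below them and the
minimum saturates. -/
theorem eventually_Psi_eq_one {κ : Measure X} [IsFiniteMeasure κ] {A : ℝ → Set X} {A₀ : Set X}
    (h : Tendsto (fun p => κ.real (A p)) (𝓝[>] 0) (𝓝 (κ.real A₀))) (hA₀ : κ A₀ ≠ 0) :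
    ∀ᶠ p in 𝓝[>] (0 : ℝ), Psi p (κ (A p)) = 1 := by
  have hpos : 0 < κ.real A₀ := ENNReal.toReal_pos hA₀ (measure_ne_top _ _)
  have hid : Tendsto (fun p : ℝ => p) (𝓝[>] 0) (𝓝 0) :=
    tendsto_nhdsWithin_of_tendsto_nhds tendsto_id
  filter_upwards [hid.eventually_lt h hpos, self_mem_nhdsWithin] with p hp hp0
  refine min_eq_right ?_
  rw [ENNReal.le_div_iff_mul_le (Or.inl (by simpa using hp0)) (Or.inl ENNReal.ofReal_ne_top),
    one_mul]
  exact ENNReal.ofReal_le_of_le_toReal hp.le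

/-- If `riskPsi` of `A p` with `Ψ_p` is at most the adversarial risk of every Borel set, then the
weak-* limit of the `A p` has a representative that minimizes the adversarial risk. -/
theorem exists_isBorelMinimizer_riskAdv [BorelSpace X] [IsProbabilityMeasure μ]
    (hsupp : rho μ (rho μ).supportᶜ = 0) (hm : AEMeasurable m (rho μ))
    (hprob : ∀ᵐ x ∂(rho μ), IsProbabilityMeasure (m x))
    (hball : BallCompatible (rho μ) m ε) (hdom : DominatesData (rho μ) m ε)
    {A : ℝ → Set X} {A₀ : Set X} (hA₀ : MeasurableSet A₀)
    (hA : ∀ p, 0 < p → MeasurableSet (A p))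
    (hle : ∀ p, 0 < p → ∀ B, MeasurableSet B → riskPsi μ m (Psi p) (A p) ≤ riskAdv μ ε B)
    (hconv : WeakStarConverges (nu μ m) A A₀) :
    ∃ A' : Set X, nu μ m (symmDiff A' A₀) = 0 ∧ IsBorelMinimizer (riskAdv μ ε) A' := by
  obtain ⟨A', hA', hsymm, hrep⟩ := exists_representative hsupp hm hball hdom hA₀
  refine ⟨A', hsymm, hA', fun B hB => ?_⟩
  have := isFiniteMeasure_nu hm hprob
  -- Fatou's lemma is applied along a sequence `u n ↓ 0`.
  obtain ⟨u, -, hu0, hu⟩ := exists_seq_strictAnti_tendsto (0 : ℝ)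
  have hu' : Tendsto u atTop (𝓝[>] 0) :=
    tendsto_nhdsWithin_iff.2 ⟨hu, Eventually.of_forall hu0⟩
  have hS : ∀ᵐ x ∂(rho μ), x ∈ (rho μ).support := hsupp
  let f : ℕ → X × Fin 2 → ℝ≥0∞ := fun n z =>
    if z.2 = 1 then Psi (u n) (m z.1 (A (u n))ᶜ) else Psi (u n) (m z.1 (A (u n)))
  have hf : ∀ n, AEMeasurable (f n) μ := fun n => by
    have h0 := (aemeasurable_Psi hm (u n) (hA _ (hu0 n))).comp_quasiMeasurePreserving
      ⟨measurable_fst, Measure.AbsolutelyContinuous.refl (rho μ)⟩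
    have h1 := (aemeasurable_Psi hm (u n) (hA _ (hu0 n)).compl).comp_quasiMeasurePreserving
      ⟨measurable_fst, Measure.AbsolutelyContinuous.refl (rho μ)⟩
    have hs : MeasurableSet {z : X × Fin 2 | z.2 = 1} :=
      measurable_snd (measurableSet_singleton 1)
    refine ⟨fun z => if z.2 = 1 then h1.mk _ z else h0.mk _ z,
      Measurable.ite hs h1.measurable_mk h0.measurable_mk, ?_⟩
    filter_upwards [h0.ae_eq_mk, h1.ae_eq_mk] with z hz0 hz1
    simp only [f, ← hz0, ← hz1, Function.comp_apply]
  have hpt : ∀ᵐ x ∂(rho μ), ∀ i : Fin 2,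
      (if i = 1 then (⋃ a ∈ A'ᶜ, Metric.ball a ε).indicator 1 x
        else (⋃ a ∈ A', Metric.ball a ε).indicator 1 x) ≤ liminf (fun n => f n (x, i)) atTop := by
    filter_upwards [hS, hprob] with x hx hxp i
    have hac := absolutelyContinuous_nu hsupp hm hball hx
    have hlim := hconv.tendsto_measureReal hac hA₀ hA
    have hlimc : Tendsto (fun p => (m x).real (A p)ᶜ) (𝓝[>] 0) (𝓝 ((m x).real A₀ᶜ)) := by
      rw [probReal_compl_eq_one_sub hA₀]
      refine (tendsto_const_nhds.sub hlim).congr' ?_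
      filter_upwards [self_mem_nhdsWithin] with p hp
      rw [probReal_compl_eq_one_sub (hA p hp)]
    have hone : ∀ {C : Set X} {A₁ : Set X} {A₂ : ℝ → Set X} {g : ℕ → ℝ≥0∞},
        (m x A₁ = 0 → x ∉ C) →
        Tendsto (fun p => (m x).real (A₂ p)) (𝓝[>] 0) (𝓝 ((m x).real A₁)) →
        (∀ n, g n = Psi (u n) (m x (A₂ (u n)))) → C.indicator 1 x ≤ liminf g atTop := by
      intro C A₁ A₂ g hC hlim₂ hg
      by_cases hxC : x ∈ C
      · refine le_liminf_of_le (by isBoundedDefault) ?_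
        filter_upwards [hu'.eventually (eventually_Psi_eq_one hlim₂ fun h => hC h hxC)] with n hn
        rw [hg, hn]
        simp [hxC]
      · simp [hxC]
    split_ifs with hi
    · exact hone (hrep x hx).2 hlimc fun n => by simp [f, hi]
    · exact hone (hrep x hx).1 hlim fun n => by simp [f, hi]
  calc riskAdv μ ε A' ≤ ∫⁻ z, liminf (fun n => f n z) atTop ∂μ :=
        lintegral_mono_ae ((ae_of_ae_map measurable_fst.aemeasurable hpt).mono fun z hz => hz z.2)
    _ ≤ liminf (fun n => ∫⁻ z, f n z ∂μ) atTop := lintegral_liminf_le' hf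
    _ ≤ liminf (fun _ : ℕ => riskAdv μ ε B) atTop := by
        refine liminf_le_liminf (Eventually.of_forall fun n => ?_)
        exact (riskPsi_eq_lintegral hm _ (hA _ (hu0 n))).symm.trans_le (hle _ (hu0 n) B hB)
    _ = riskAdv μ ε B := liminf_const _

end ProbRobust

theorem mainTheorem10 {X : Type*} [MetricSpace X] [MeasurableSpace X] [BorelSpace X]
    (μ : Measure (X × Fin 2)) [IsProbabilityMeasure μ]
    (hsupp : ProbRobust.rho μ (ProbRobust.rho μ).supportᶜ = 0)
    (m : X → Measure X) (hm : AEMeasurable m (ProbRobust.rho μ))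
    (hprob : ∀ᵐ x ∂(ProbRobust.rho μ), IsProbabilityMeasure (m x))
    (ε : ℝ) (hε : 0 < ε)
    (hball : ProbRobust.BallCompatible (ProbRobust.rho μ) m ε)
    (hdom : ProbRobust.DominatesData (ProbRobust.rho μ) m ε) :
    (∀ (A : ℝ → Set X) (A₀ : Set X), MeasurableSet A₀ →
      (∀ p : ℝ, 0 < p →
        ProbRobust.IsBorelMinimizer (ProbRobust.probRisk μ m (ProbRobust.Psi p)) (A p)) →
      ProbRobust.WeakStarConverges (ProbRobust.nu μ m) A A₀ →
      ∃ A' : Set X, ProbRobust.nu μ m (symmDiff A' A₀) = 0 ∧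
        ProbRobust.IsBorelMinimizer (ProbRobust.riskAdv μ ε) A') ∧
    (∀ (A : ℝ → Set X) (A₀ : Set X), MeasurableSet A₀ →
      (∀ p : ℝ, 0 < p →
        ProbRobust.IsBorelMinimizer (ProbRobust.riskPsi μ m (ProbRobust.Psi p)) (A p)) →
      ProbRobust.WeakStarConverges (ProbRobust.nu μ m) A A₀ →
      ∃ A' : Set X, ProbRobust.nu μ m (symmDiff A' A₀) = 0 ∧
        ProbRobust.IsBorelMinimizer (ProbRobust.riskAdv μ ε) A') := by
  have hpa : ∀ {p : ℝ} {B : Set X}, MeasurableSet B →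
      ProbRobust.probRisk μ m (ProbRobust.Psi p) B ≤ ProbRobust.riskAdv μ ε B := fun hB =>
    ProbRobust.probRisk_le_riskAdv hsupp hball hε _ hB
  refine ⟨fun A A₀ hA₀ hmin hconv => ?_, fun A A₀ hA₀ hmin hconv => ?_⟩
  · exact ProbRobust.exists_isBorelMinimizer_riskAdv hsupp hm hprob hball hdom hA₀
      (fun p hp => (hmin p hp).1) (fun p hp B hB =>
        (ProbRobust.riskPsi_le_probRisk p (hmin p hp).1).trans
          (((hmin p hp).2 B hB).trans (hpa hB))) hconv
  · exact ProbRobust.exists_isBorelMinimizer_riskAdv hsupp hm hprob hball hdom hA₀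
      (fun p hp => (hmin p hp).1) (fun p hp B hB =>
        ((hmin p hp).2 B hB).trans ((ProbRobust.riskPsi_le_probRisk p hB).trans (hpa hB))) hconv
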